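/- Let $\mathcal Z$ be a complex Hilbert space, let $A$ be the generator of a $C_0$-semigroup on $\mathcal Z$, let $Bu=u\,b$ and $Cx=\langle x,c\rangle$ for some non-zero $b,c\in\mathcal Z$, and let $D\in\mathbb C$. Assume that the spectrum $\sigma(A)$ is non-empty and consists of isolated eigenvalues of finite algebraic multiplicity only (the algebraic multiplicity of an isolated point $\lambda$ of $\sigma(A)$ is the dimension of the range of its Riesz projection $\frac{1}{2\pi i}\oint_{|z-\lambda|=r}(zI-A)^{-1}\,dz$, $r>0$ small). Let $\rho(A)=\mathbb C\setminus\sigma(A)$ and let $G(s)=C(sI-A)^{-1}B+D$, $s\in\rho(A)$, be the transfer function of the system $\Sigma(A,B,C,D)$. An invariant zero of the system is a number $\lambda\in\mathbb C$ for which there are $x\in D(A)$, $x\neq 0$, and $u\in\mathbb C$ with $$(\lambda I-A)x-Bu=0,\qquad Cx+Du=0 .$$ Suppose that the system is minimal, that is, no invariant zero belongs to $\sigma(A)$. Then $G$ is holomorphic on $\rho(A)$ and meromorphic on $\mathbb C$, and each $\lambda\in\sigma(A)$ is a pole of $G$ (a genuine one, not a removable singularity). In particular, $G$ is not identically zero on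 $\rho(A)$. -/

import Mathlib

open Filter Topology

noncomputable section

/-! ### Unbounded operators: resolvent set, spectrum, resolvent, Riesz projection -/

section Operator

variable {Z : Type*} [NormedAddCommGroup Z] [InnerProductSpace ℂ Z]

/-- The bounded operator `R`, defined on all of `Z`, is a two-sided inverse of
`s I - A : D(A) → Z`. -/
def IsResolventAt (A : Z →ₗ.[ℂ] Z) (s : ℂ) (R : Z →L[ℂ] Z) : Prop :=
  (∀ z : Z, ∃ x : A.domain, (x : Z) = R z ∧ s • (x : Z) - A x = z) ∧
    ∀ x : A.domain, R (s • (x : Z) - A x) = (x : Z)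

/-- The resolvent set `ρ(A)`. -/
def opResolventSet (A : Z →ₗ.[ℂ] Z) : Set ℂ :=
  {s | ∃ R : Z →L[ℂ] Z, IsResolventAt A s R}

/-- The spectrum `σ(A) = ℂ \ ρ(A)`. -/
def opSpectrum (A : Z →ₗ.[ℂ] Z) : Set ℂ :=
  (opResolventSet A)ᶜ

open Classical in
/-- The resolvent `(s I - A)⁻¹` for `s ∈ ρ(A)` (and the zero operator for `s ∈ σ(A)`). -/
def opResolvent (A : Z →ₗ.[ℂ] Z) (s : ℂ) : Z →L[ℂ] Z :=
  if h : s ∈ opResolventSet A then Classical.choose h else 0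

/-- On the resolvent set, `opResolvent A s` is the inverse of `s I - A`. -/
theorem isResolventAt_opResolvent {A : Z →ₗ.[ℂ] Z} {s : ℂ} (h : s ∈ opResolventSet A) :
    IsResolventAt A s (opResolvent A s) := by
  have h2 : opResolvent A s = Classical.choose h := dif_pos h
  rw [h2]
  exact Classical.choose_spec h

/-- The bounded inverse of `s I - A` is unique. -/
theorem IsResolventAt.unique {A : Z →ₗ.[ℂ] Z} {s : ℂ} {R R' : Z →L[ℂ] Z}
    (h : IsResolventAt A s R) (h' : IsResolventAt A s R') : R = R' := by
  ext z
  obtain ⟨x, hx, hz⟩ := h.1 z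
  rw [← hx, ← hz, h'.2 x]

/-- `μ` is an eigenvalue of `A`. -/
def IsOpEigenvalue (A : Z →ₗ.[ℂ] Z) (μ : ℂ) : Prop :=
  ∃ x : A.domain, (x : Z) ≠ 0 ∧ A x = μ • (x : Z)

/-- The Riesz projection `(2πi)⁻¹ ∮ (z I - A)⁻¹ dz` over the circle `|z - μ| = r`. -/
def rieszProjection (A : Z →ₗ.[ℂ] Z) (μ : ℂ) (r : ℝ) : Z →L[ℂ] Z :=
  (2 * (Real.pi : ℂ) * Complex.I)⁻¹ • ∮ z in C(μ, r), opResolvent A z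

/-- `μ` is an isolated point of `σ(A)`, it is an eigenvalue of `A`, and its algebraic multiplicity,
i.e. the dimension of the range of the associated Riesz projection, is finite. -/
def IsIsolatedEigenvalueOfFiniteMultiplicity (A : Z →ₗ.[ℂ] Z) (μ : ℂ) : Prop :=
  IsOpEigenvalue A μ ∧
    ∃ r : ℝ, 0 < r ∧ opSpectrum A ∩ Metric.closedBall μ r = {μ} ∧
      FiniteDimensional ℂ (LinearMap.range (rieszProjection A μ r : Z →ₗ[ℂ] Z))

end Operator

/-! ### Strongly continuous semigroups and their generators -/

section Semigroup

variable {Z : Type*} [NormedAddCommGroup Z] [InnerProductSpace ℂ Z]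

/-- `(T(t))_{t ≥ 0}` is a `C₀`-semigroup of bounded operators on `Z`. -/
structure IsC0Semigroup (T : NNReal → Z →L[ℂ] Z) : Prop where
  map_zero : T 0 = ContinuousLinearMap.id ℂ Z
  map_add : ∀ s t : NNReal, T (s + t) = (T s).comp (T t)
  tendsto_zero : ∀ x : Z, Tendsto (fun t => T t x) (𝓝 0) (𝓝 x)

/-- `A` is the generator of `(T(t))_{t ≥ 0}`: `x ∈ D(A)` and `A x = y` if and only if
`(T(h) x - x) / h → y` as `h ↓ 0`. -/
def IsGeneratorOf (A : Z →ₗ.[ℂ] Z) (T : NNReal → Z →L[ℂ] Z) : Prop :=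
  ∀ x y : Z, (x, y) ∈ A.graph ↔
    Tendsto (fun h : NNReal => ((h : ℝ) : ℂ)⁻¹ • (T h x - x)) (𝓝[>] 0) (𝓝 y)

/-- `A` is the generator of some `C₀`-semigroup. -/
def GeneratesC0Semigroup (A : Z →ₗ.[ℂ] Z) : Prop :=
  ∃ T : NNReal → Z →L[ℂ] Z, IsC0Semigroup T ∧ IsGeneratorOf A T

end Semigroup

/-! ### Single-input single-output control systems -/

/-- A control system `Σ(A,B,C,D)` with `B u = u b`, `C x = ⟨x, c⟩`, `b, c ≠ 0`, where `A` generates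
a `C₀`-semigroup. -/
structure ControlSystem (Z : Type*) [NormedAddCommGroup Z] [InnerProductSpace ℂ Z] where
  A : Z →ₗ.[ℂ] Z
  generates : GeneratesC0Semigroup A
  b : Z
  c : Z
  D : ℂ
  b_ne_zero : b ≠ 0
  c_ne_zero : c ≠ 0

namespace ControlSystem

variable {Z : Type*} [NormedAddCommGroup Z] [InnerProductSpace ℂ Z]

/-- The input operator `B u = u b`. -/
def B (S : ControlSystem Z) : ℂ →L[ℂ] Z :=
  ContinuousLinearMap.toSpanSingleton ℂ S.b

/-- The output operator `C x = ⟨x, c⟩`, where the inner product is linear in `x`; in Mathlib the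
linear slot of the inner product is the second one. -/
def C (S : ControlSystem Z) : Z →L[ℂ] ℂ :=
  innerSL ℂ S.c

/-- The transfer function `G(s) = C (s I - A)⁻¹ B + D`, for `s ∈ ρ(A)`. -/
def transferFunction (S : ControlSystem Z) (s : ℂ) : ℂ :=
  S.C (opResolvent S.A s (S.B 1)) + S.D

/-- The set of invariant zeros of the system. -/
def invariantZeros (S : ControlSystem Z) : Set ℂ :=
  {s | ∃ (x : S.A.domain) (u : ℂ), (x : Z) ≠ 0 ∧
    s • (x : Z) - S.A x - S.B u = 0 ∧ S.C (x : Z) + S.D * u = 0}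

/-- The system is minimal if no invariant zero lies in the spectrum of `A`. -/
def IsMinimal (S : ControlSystem Z) : Prop :=
  S.invariantZeros ∩ opSpectrum S.A = ∅

end ControlSystem

end

/-! Fix `μ` in the spectrum, with Riesz projection `P`, and write `R s` for the resolvent. The
resolvent identity gives `R s b = R s (P b) + H s b`, where `H` is a Cauchy integral and so analytic
at `μ`; the other term solves a linear system on the finite-dimensional range of `P`, so it is
meromorphic by Cramer's rule. Either `R s b` has a pole at `μ` whose leading coefficient is an
eigenvector, or letting `s → μ` puts `b` in the range of `μ I - A`. Minimality forbids the latter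
and keeps `C` from killing eigenvectors: a bad eigenvector is an invariant zero with `u = 0`, while
a preimage of `b`, corrected by an eigenvector, gives one with `u = 1`. Hence the pole survives in
`G`, and adding the constant `D` does not affect it. -/

/-! ### Resolvent identity and analyticity of the resolvent -/

theorem IsResolventAt.apply_sub_apply {Z : Type*} [NormedAddCommGroup Z] [InnerProductSpace ℂ Z]
    {A : Z →ₗ.[ℂ] Z} {s t : ℂ} {R R' : Z →L[ℂ] Z}
    (h : IsResolventAt A s R) (h' : IsResolventAt A t R') (z : Z) :
    R z - R' z = (t - s) • R (R' z) := by
  obtain ⟨x, hx, hz⟩ := h'.1 z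
  have h1 := h.2 x
  have h2 : s • (x : Z) - A x = z + (s - t) • R' z := by
    rw [← hx, sub_smul, ← add_sub_assoc, eq_sub_iff_add_eq]
    rw [← hz]
    module
  rw [h2, map_add, map_smul, hx] at h1
  rw [← sub_eq_zero]
  rw [← sub_eq_zero] at h1
  rw [← h1]; module

theorem IsResolventAt.mul_comm {Z : Type*} [NormedAddCommGroup Z] [InnerProductSpace ℂ Z]
    {A : Z →ₗ.[ℂ] Z} {s t : ℂ} {R R' : Z →L[ℂ] Z}
    (h : IsResolventAt A s R) (h' : IsResolventAt A t R') : R * R' = R' * R := by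
  rcases eq_or_ne s t with rfl | hst
  · rw [h.unique h']
  · ext z
    have h1 := h.apply_sub_apply h' z
    have h2 := h'.apply_sub_apply h z
    have h3 : (t - s) • R (R' z) = (t - s) • R' (R z) := by
      rw [← h1, ← neg_sub (R' z), h2]; module
    exact smul_right_injective Z (sub_ne_zero.2 hst.symm) h3

theorem IsResolventAt.injective {Z : Type*} [NormedAddCommGroup Z] [InnerProductSpace ℂ Z]
    {A : Z →ₗ.[ℂ] Z} {s : ℂ} {R : Z →L[ℂ] Z} (h : IsResolventAt A s R) :
    Function.Injective R := by
  rw [injective_iff_map_eq_zero]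
  intro z hz
  obtain ⟨x, hx, hxz⟩ := h.1 z
  have hx0 : x = 0 := Subtype.ext (by rw [hx, hz]; rfl)
  rw [← hxz, hx0]; simp

/-- The equation `(λ I - A) x = z`, expressed through the resolvent at another point. -/
theorem IsResolventAt.exists_of_apply_eq {Z : Type*} [NormedAddCommGroup Z]
    [InnerProductSpace ℂ Z] {A : Z →ₗ.[ℂ] Z} {s t : ℂ} {R : Z →L[ℂ] Z} (h : IsResolventAt A s R)
    {x z : Z} (hx : x = R (z + (s - t) • x)) :
    ∃ y : A.domain, (y : Z) = x ∧ t • (y : Z) - A y = z := by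
  obtain ⟨y, hy, hyz⟩ := h.1 (z + (s - t) • x)
  rw [← hx] at hy
  refine ⟨y, hy, ?_⟩
  have : A y = s • (y : Z) - (z + (s - t) • x) := by rw [← hyz]; module
  rw [this, hy]; module

/-- Follows from the factorization `t I - A = (1 + (t - s) R) (s I - A)` on `D(A)`. -/
theorem IsResolventAt.mul_inverse {Z : Type*} [NormedAddCommGroup Z] [InnerProductSpace ℂ Z]
    {A : Z →ₗ.[ℂ] Z} {s t : ℂ} {R : Z →L[ℂ] Z} (h : IsResolventAt A s R)
    (hu : IsUnit (1 + (t - s) • R)) :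
    IsResolventAt A t (R * Ring.inverse (1 + (t - s) • R)) := by
  have h1 := Ring.mul_inverse_cancel _ hu
  have h2 := Ring.inverse_mul_cancel _ hu
  set V := Ring.inverse (1 + (t - s) • R)
  constructor
  · intro z
    obtain ⟨x, hx, hz⟩ := h.1 (V z)
    refine ⟨x, hx, ?_⟩
    have h3 := congrArg (fun W : Z →L[ℂ] Z => W z) h1
    simp only [mul_apply_eq_comp, add_apply,
      one_apply_eq_self, smul_apply] at h3
    have h4 : t • (x : Z) - A x = V z + (t - s) • R (V z) := by rw [← hx, ← hz]; module
    rw [h4, h3]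
  · intro x
    have h3 := congrArg (fun W : Z →L[ℂ] Z => W (s • (x : Z) - A x)) h2
    simp only [mul_apply_eq_comp, add_apply,
      one_apply_eq_self, smul_apply, h.2 x] at h3
    have h4 : t • (x : Z) - A x = s • (x : Z) - A x + (t - s) • (x : Z) := by module
    rw [mul_apply_eq_comp, h4, h3, h.2 x]

theorem eventually_opResolvent_eq {Z : Type*} [NormedAddCommGroup Z] [InnerProductSpace ℂ Z]
    [CompleteSpace Z] {A : Z →ₗ.[ℂ] Z} {s : ℂ} (hs : s ∈ opResolventSet A) :
    ∀ᶠ t in 𝓝 s, t ∈ opResolventSet A ∧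
      opResolvent A t =
        opResolvent A s * Ring.inverse (1 + (t - s) • opResolvent A s) := by
  have hc : ContinuousAt (fun t : ℂ => 1 + (t - s) • opResolvent A s) s := by fun_prop
  have hu : ∀ᶠ t in 𝓝 s, IsUnit (1 + (t - s) • opResolvent A s) := by
    refine hc.eventually (Units.isOpen.mem_nhds ?_)
    simp
  filter_upwards [hu] with t ht
  have h := (isResolventAt_opResolvent hs).mul_inverse ht
  exact ⟨⟨_, h⟩, (isResolventAt_opResolvent ⟨_, h⟩).unique h⟩

theorem analyticAt_opResolvent {Z : Type*} [NormedAddCommGroup Z] [InnerProductSpace ℂ Z]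
    [CompleteSpace Z] {A : Z →ₗ.[ℂ] Z} {s : ℂ} (hs : s ∈ opResolventSet A) :
    AnalyticAt ℂ (opResolvent A) s := by
  have h1 : AnalyticAt ℂ (fun t : ℂ => 1 + (t - s) • opResolvent A s) s := by fun_prop
  have h2 : AnalyticAt ℂ (Ring.inverse (M₀ := Z →L[ℂ] Z)) (1 + (s - s) • opResolvent A s) := by
    simpa using analyticAt_inverse (𝕜 := ℂ) (1 : (Z →L[ℂ] Z)ˣ)
  have h3 : AnalyticAt ℂ (fun t => opResolvent A s *
      Ring.inverse (1 + (t - s) • opResolvent A s)) s :=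
    analyticAt_const.mul (h2.fun_comp (f := fun t : ℂ => 1 + (t - s) • opResolvent A s) h1)
  exact h3.congr ((eventually_opResolvent_eq hs).mono fun _ h => h.2.symm)

/-! ### Linear systems with an analytic parameter -/

theorem Matrix.analyticAt_det {𝕜 n : Type*} [NontriviallyNormedField 𝕜] [Fintype n]
    [DecidableEq n] {M : 𝕜 → Matrix n n 𝕜} {a : 𝕜}
    (hM : ∀ i j, AnalyticAt 𝕜 (fun s => M s i j) a) : AnalyticAt 𝕜 (fun s => (M s).det) a := by
  simp only [Matrix.det_apply']
  exact Finset.analyticAt_fun_sum _ fun σ _ =>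
    analyticAt_const.mul (Finset.analyticAt_fun_prod _ fun i _ => hM _ _)

theorem Matrix.analyticAt_adjugate {𝕜 n : Type*} [NontriviallyNormedField 𝕜] [Fintype n]
    [DecidableEq n] {M : 𝕜 → Matrix n n 𝕜} {a : 𝕜}
    (hM : ∀ i j, AnalyticAt 𝕜 (fun s => M s i j) a) (i j : n) :
    AnalyticAt 𝕜 (fun s => (M s).adjugate i j) a := by
  simp only [Matrix.adjugate_apply]
  refine Matrix.analyticAt_det fun k l => ?_
  simp only [Matrix.updateRow_apply]
  split_ifs
  · exact analyticAt_const
  · exact hM k l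

/-- A family of solutions of `x + (s - s₀) T x = y` in a finite-dimensional space depends
meromorphically on `s`, as long as the solutions are unique. -/
theorem meromorphicAt_of_add_smul_eq {E : Type*} [NormedAddCommGroup E] [NormedSpace ℂ E]
    {F : Submodule ℂ E} [FiniteDimensional ℂ F] (T : F →ₗ[ℂ] F) (y : F) {f : ℂ → E} {s₀ μ : ℂ}
    (hinj : ∀ᶠ s in 𝓝[≠] μ, Function.Injective ((1 : F →ₗ[ℂ] F) + (s - s₀) • T))
    (hf : ∀ᶠ s in 𝓝[≠] μ, ∃ x : F, (x : E) = f s ∧ x + (s - s₀) • T x = y) :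
    MeromorphicAt f μ := by
  classical
  let b := Module.finBasis ℂ F
  let M : ℂ → Matrix _ _ ℂ := fun s => LinearMap.toMatrix b b (1 + (s - s₀) • T)
  have hM : ∀ i j, AnalyticAt ℂ (fun s => M s i j) μ := by
    intro i j
    simp only [M, map_add, map_smul, Matrix.add_apply, Matrix.smul_apply]
    fun_prop
  -- Cramer's rule.
  have hmer : MeromorphicAt
      (fun s => ∑ i, ((M s).det⁻¹ * ∑ j, (M s).adjugate i j * b.repr y j) • (b i : E)) μ := by
    refine MeromorphicAt.fun_sum fun i _ => MeromorphicAt.smul (MeromorphicAt.mul ?_ ?_)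
      (MeromorphicAt.const _ _)
    · exact (Matrix.analyticAt_det hM).meromorphicAt.inv
    · exact MeromorphicAt.fun_sum fun j _ =>
        (Matrix.analyticAt_adjugate hM i j).meromorphicAt.mul (MeromorphicAt.const _ _)
  refine hmer.congr ?_
  filter_upwards [hinj, hf] with s hs ⟨x, hxf, hx⟩
  have hdet : (M s).det ≠ 0 := by
    rw [LinearMap.det_toMatrix]
    exact (LinearMap.isUnit_det _ ((LinearMap.isUnit_iff_ker_eq_bot _).2
      (LinearMap.ker_eq_bot.2 hs))).ne_zero
  have h1 : (M s).mulVec (b.repr x) = b.repr y := by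
    rw [LinearMap.toMatrix_mulVec_repr, ← hx]; rfl
  have h2 : (M s).det • (b.repr x : _ → ℂ) = (M s).adjugate.mulVec (b.repr y) := by
    rw [← h1, Matrix.mulVec_mulVec, Matrix.adjugate_mul, Matrix.smul_mulVec, Matrix.one_mulVec]
  have h3 : ∀ i, (M s).det⁻¹ * ∑ j, (M s).adjugate i j * b.repr y j = b.repr x i := by
    intro i
    have := congrFun h2 i
    simp only [Pi.smul_apply, smul_eq_mul, Matrix.mulVec, dotProduct] at this
    rw [← this, inv_mul_cancel_left₀ hdet]
  simp only [h3]
  rw [← hxf]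
  conv_rhs => rw [← b.sum_repr x]
  simp only [AddSubmonoidClass.coe_finsetSum, Submodule.coe_smul]

/-! ### Riesz projection and meromorphy of the resolvent -/

theorem ContinuousLinearMap.map_circleIntegral {E F : Type*} [NormedAddCommGroup E]
    [NormedSpace ℂ E] [CompleteSpace E] [NormedAddCommGroup F] [NormedSpace ℂ F] [CompleteSpace F]
    (L : E →L[ℂ] F) {f : ℂ → E} {c : ℂ} {r : ℝ} (hf : CircleIntegrable f c r) :
    L (∮ z in C(c, r), f z) = ∮ z in C(c, r), L (f z) := by
  unfold circleIntegral
  rw [← L.intervalIntegral_comp_comm hf.out]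
  simp

theorem mem_opResolventSet_of_mem_closedBall {Z : Type*} [NormedAddCommGroup Z]
    [InnerProductSpace ℂ Z] {A : Z →ₗ.[ℂ] Z} {μ s : ℂ} {r : ℝ}
    (hμ : opSpectrum A ∩ Metric.closedBall μ r = {μ}) (hs : s ∈ Metric.closedBall μ r)
    (hne : s ≠ μ) : s ∈ opResolventSet A := by
  by_contra h
  have : s ∈ opSpectrum A ∩ Metric.closedBall μ r := ⟨h, hs⟩
  rw [hμ] at this
  exact hne this

theorem mem_opResolventSet_of_mem_sphere {Z : Type*} [NormedAddCommGroup Z]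
    [InnerProductSpace ℂ Z] {A : Z →ₗ.[ℂ] Z} {μ s : ℂ} {r : ℝ} (hr : 0 < r)
    (hμ : opSpectrum A ∩ Metric.closedBall μ r = {μ}) (hs : s ∈ Metric.sphere μ r) :
    s ∈ opResolventSet A :=
  mem_opResolventSet_of_mem_closedBall hμ (Metric.sphere_subset_closedBall hs)
    (Metric.ne_of_mem_sphere hs hr.ne')

theorem eventually_mem_opResolventSet {Z : Type*} [NormedAddCommGroup Z]
    [InnerProductSpace ℂ Z] {A : Z →ₗ.[ℂ] Z} {μ : ℂ} {r : ℝ} (hr : 0 < r)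
    (hμ : opSpectrum A ∩ Metric.closedBall μ r = {μ}) :
    ∀ᶠ s in 𝓝[≠] μ, s ∈ opResolventSet A := by
  filter_upwards [self_mem_nhdsWithin, nhdsWithin_le_nhds (Metric.closedBall_mem_nhds μ hr)]
    with s hs hs'
  exact mem_opResolventSet_of_mem_closedBall hμ hs' hs

theorem circleIntegrable_opResolvent {Z : Type*} [NormedAddCommGroup Z]
    [InnerProductSpace ℂ Z] [CompleteSpace Z] {A : Z →ₗ.[ℂ] Z} {μ : ℂ} {r : ℝ} (hr : 0 < r)
    (hμ : opSpectrum A ∩ Metric.closedBall μ r = {μ}) :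
    CircleIntegrable (opResolvent A) μ r :=
  ContinuousOn.circleIntegrable hr.le fun _ hz =>
    (analyticAt_opResolvent
      (mem_opResolventSet_of_mem_sphere hr hμ hz)).continuousAt.continuousWithinAt

/-- Resolvents commute, so this passes to the contour integral; it makes the range of the projection
invariant under the resolvent. -/
theorem opResolvent_mul_rieszProjection_comm {Z : Type*} [NormedAddCommGroup Z]
    [InnerProductSpace ℂ Z] [CompleteSpace Z] {A : Z →ₗ.[ℂ] Z} {μ s : ℂ} {r : ℝ} (hr : 0 < r)
    (hμ : opSpectrum A ∩ Metric.closedBall μ r = {μ}) (hs : s ∈ opResolventSet A) :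
    opResolvent A s * rieszProjection A μ r = rieszProjection A μ r * opResolvent A s := by
  have hi := circleIntegrable_opResolvent hr hμ
  have h1 := (ContinuousLinearMap.mul ℂ (Z →L[ℂ] Z) (opResolvent A s)).map_circleIntegral hi
  have h2 := ((ContinuousLinearMap.mul ℂ (Z →L[ℂ] Z)).flip (opResolvent A s)).map_circleIntegral hi
  simp only [ContinuousLinearMap.mul_apply', ContinuousLinearMap.flip_apply] at h1 h2
  rw [rieszProjection, mul_smul_comm, smul_mul_assoc, h1, h2]
  congr 1
  refine circleIntegral.integral_congr hr.le fun z hz => ?_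
  exact (isResolventAt_opResolvent hs).mul_comm
    (isResolventAt_opResolvent (mem_opResolventSet_of_mem_sphere hr hμ hz))

/-- The part of the resolvent outside of the Riesz projection is a Cauchy integral. -/
theorem opResolvent_mul_rieszProjection {Z : Type*} [NormedAddCommGroup Z]
    [InnerProductSpace ℂ Z] [CompleteSpace Z] {A : Z →ₗ.[ℂ] Z} {μ s : ℂ} {r : ℝ} (hr : 0 < r)
    (hμ : opSpectrum A ∩ Metric.closedBall μ r = {μ}) (hs : s ∈ opResolventSet A)
    (hsr : s ∈ Metric.ball μ r) :
    opResolvent A s * rieszProjection A μ r = opResolvent A s -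
      (2 * (Real.pi : ℂ) * Complex.I)⁻¹ • ∮ z in C(μ, r), (z - s)⁻¹ • opResolvent A z := by
  have hi := circleIntegrable_opResolvent hr hμ
  have hne : ∀ z ∈ Metric.sphere μ r, z - s ≠ 0 := by
    intro z hz h
    rw [sub_eq_zero.1 h, Metric.mem_sphere] at hz
    exact (Metric.mem_ball.1 hsr).ne hz
  have hc : ContinuousOn (fun z => (z - s)⁻¹) (Metric.sphere μ r) :=
    (continuousOn_id.sub continuousOn_const).inv₀ hne
  have hcR : ContinuousOn (opResolvent A) (Metric.sphere μ r) := fun z hz =>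
    (analyticAt_opResolvent
      (mem_opResolventSet_of_mem_sphere hr hμ hz)).continuousAt.continuousWithinAt
  have h1 := (ContinuousLinearMap.mul ℂ (Z →L[ℂ] Z) (opResolvent A s)).map_circleIntegral hi
  simp only [ContinuousLinearMap.mul_apply'] at h1
  have h2 : (∮ z in C(μ, r), opResolvent A s * opResolvent A z) =
      ∮ z in C(μ, r), ((z - s)⁻¹ • opResolvent A s - (z - s)⁻¹ • opResolvent A z) := by
    refine circleIntegral.integral_congr hr.le fun z hz => ?_
    ext x
    have h := (isResolventAt_opResolvent hs).apply_sub_apply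
      (isResolventAt_opResolvent (mem_opResolventSet_of_mem_sphere hr hμ hz)) x
    simp only [mul_apply_eq_comp, sub_apply, smul_apply]
    rw [← smul_sub, h, inv_smul_smul₀ (hne z hz)]
  have h3 : CircleIntegrable (fun z => (z - s)⁻¹ • opResolvent A s) μ r :=
    (hc.smul continuousOn_const).circleIntegrable hr.le
  have h4 : CircleIntegrable (fun z => (z - s)⁻¹ • opResolvent A z) μ r :=
    (hc.smul hcR).circleIntegrable hr.le
  rw [rieszProjection, mul_smul_comm, h1, h2, circleIntegral.integral_sub h3 h4,
    circleIntegral.integral_smul_const, circleIntegral.integral_sub_inv_of_mem_ball hsr, smul_sub,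
    inv_smul_smul₀ Complex.two_pi_I_ne_zero]

theorem meromorphicAt_opResolvent_apply {Z : Type*} [NormedAddCommGroup Z]
    [InnerProductSpace ℂ Z] [CompleteSpace Z] {A : Z →ₗ.[ℂ] Z} {μ : ℂ}
    (hμ : IsIsolatedEigenvalueOfFiniteMultiplicity A μ) (b : Z) :
    MeromorphicAt (fun s => opResolvent A s b) μ := by
  obtain ⟨-, r, hr, hμ, hfin⟩ := hμ
  have hres := eventually_mem_opResolventSet hr hμ
  set P := rieszProjection A μ r
  let F : Submodule ℂ Z := LinearMap.range (P : Z →ₗ[ℂ] Z)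
  have : FiniteDimensional ℂ F := hfin
  have hF : ∀ s ∈ opResolventSet A, ∀ x ∈ F, opResolvent A s x ∈ F := by
    rintro s hs _ ⟨y, rfl⟩
    refine ⟨opResolvent A s y, ?_⟩
    have h := congrArg (fun W : Z →L[ℂ] Z => W y) (opResolvent_mul_rieszProjection_comm hr hμ hs)
    simpa using h.symm
  obtain ⟨s₀, hs₀⟩ := hres.exists
  have hR₀ := isResolventAt_opResolvent hs₀
  -- Restricting the bounded resolvent at `s₀` avoids restricting `A`: the resolvent identity says
  -- that `x = R s (P b)` solves `x + (s - s₀) T x = T (P b)`.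
  let T : F →ₗ[ℂ] F := (opResolvent A s₀ : Z →ₗ[ℂ] Z).restrict (hF s₀ hs₀)
  have hT : ∀ x : F, (T x : Z) = opResolvent A s₀ x := fun x => rfl
  have hPb : P b ∈ F := ⟨b, rfl⟩
  have hmer : MeromorphicAt (fun s => opResolvent A s (P b)) μ := by
    refine meromorphicAt_of_add_smul_eq T (T ⟨P b, hPb⟩) (s₀ := s₀) ?_ ?_
    · filter_upwards [hres] with s hs
      rw [injective_iff_map_eq_zero]
      intro x hx
      have hx' : (x : Z) + (s - s₀) • opResolvent A s₀ x = 0 := congrArg Subtype.val hx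
      have h := (isResolventAt_opResolvent hs).apply_sub_apply hR₀ (x : Z)
      have h' : opResolvent A s ((x : Z) + (s - s₀) • opResolvent A s₀ x) =
          opResolvent A s₀ x := by
        rw [map_add, map_smul, ← sub_eq_zero]
        rw [← sub_eq_zero] at h
        rw [← h]; module
      rw [hx', map_zero] at h'
      exact Subtype.ext (hR₀.injective (by rw [← h', ZeroMemClass.coe_zero, map_zero]))
    · filter_upwards [hres] with s hs
      refine ⟨⟨opResolvent A s (P b), hF s hs _ hPb⟩, rfl, Subtype.ext ?_⟩
      have h := hR₀.apply_sub_apply (isResolventAt_opResolvent hs) (P b)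
      simp only [Submodule.coe_add, Submodule.coe_smul, hT]
      rw [← h]; module
  have hH : AnalyticAt ℂ (fun s => (2 * (Real.pi : ℂ) * Complex.I)⁻¹ •
      ∮ z in C(μ, r), (z - s)⁻¹ • opResolvent A z) μ := by
    lift r to NNReal using hr.le
    exact (hasFPowerSeriesOn_cauchy_integral (circleIntegrable_opResolvent hr hμ)
      (by exact_mod_cast hr)).analyticAt
  have hHb := (((ContinuousLinearMap.apply ℂ Z b).analyticAt _).comp hH).meromorphicAt
  refine (hmer.add hHb).congr ?_
  filter_upwards [hres, nhdsWithin_le_nhds (Metric.ball_mem_nhds μ hr)] with s hs hsr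
  have h := congrArg (fun W : Z →L[ℂ] Z => W b) (opResolvent_mul_rieszProjection hr hμ hs hsr)
  simp only [mul_apply_eq_comp, sub_apply] at h
  change opResolvent A s (P b) + _ = _
  rw [h]
  exact sub_add_cancel _ _

/-! ### Leading Laurent coefficient of the resolvent -/

/-- If `(s I - A)⁻¹ b` has no pole at `μ`, then `b` lies in the range of `μ I - A`;
otherwise its leading coefficient at `μ` is an eigenvector of `A`. -/
theorem exists_leadingCoeff_opResolvent_apply {Z : Type*} [NormedAddCommGroup Z]
    [InnerProductSpace ℂ Z] [CompleteSpace Z] {A : Z →ₗ.[ℂ] Z} {μ : ℂ} {b : Z}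
    (hmer : MeromorphicAt (fun s => opResolvent A s b) μ)
    (hres : ∀ᶠ s in 𝓝[≠] μ, s ∈ opResolventSet A)
    (hb : ¬∃ y : A.domain, μ • (y : Z) - A y = b) :
    ∃ n : ℤ, n < 0 ∧ ∃ g : ℂ → Z, AnalyticAt ℂ g μ ∧
      (∀ᶠ s in 𝓝[≠] μ, opResolvent A s b = (s - μ) ^ n • g s) ∧ g μ ≠ 0 ∧
      ∃ y : A.domain, (y : Z) = g μ ∧ A y = μ • (y : Z) := by
  obtain ⟨s₀, hs₀⟩ := hres.exists
  have hR₀ := isResolventAt_opResolvent hs₀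
  have hb0 : b ≠ 0 := fun h => hb ⟨0, by simp [h]⟩
  have htop : meromorphicOrderAt (fun s => opResolvent A s b) μ ≠ ⊤ := by
    intro h
    obtain ⟨s, hs, hsz⟩ := (hres.and (meromorphicOrderAt_eq_top_iff.1 h)).exists
    exact hb0 ((isResolventAt_opResolvent hs).injective (by rw [hsz, map_zero]))
  obtain ⟨n, hn⟩ := WithTop.ne_top_iff_exists.1 htop
  obtain ⟨g, hg, hg0, hfg⟩ := (meromorphicOrderAt_eq_int_iff hmer).1 hn.symm
  -- A multiple of `(s I - A)⁻¹ b` with a continuous extension satisfies the resolvent equation.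
  have key : ∀ (φ : ℂ → ℂ) (h : ℂ → Z), ContinuousAt φ μ → ContinuousAt h μ →
      (∀ᶠ s in 𝓝[≠] μ, h s = φ s • opResolvent A s b) →
      ∃ y : A.domain, (y : Z) = h μ ∧ μ • (y : Z) - A y = φ μ • b := by
    intro φ h hφ hh heq
    -- In the form `h s = R s₀ (φ s • b + (s₀ - s) • h s)` the equation involves only bounded
    -- operators, so the limit `s → μ` can be taken.
    refine hR₀.exists_of_apply_eq ?_
    have hc : ContinuousAt (fun s => opResolvent A s₀ (φ s • b + (s₀ - s) • h s)) μ :=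
      (opResolvent A s₀).continuous.continuousAt.comp
        ((hφ.smul continuousAt_const).add ((continuousAt_const.sub continuousAt_id).smul hh))
    refine tendsto_nhds_unique_of_eventuallyEq (l := 𝓝[≠] μ) (hh.tendsto.mono_left nhdsWithin_le_nhds)
      (hc.tendsto.mono_left nhdsWithin_le_nhds) ?_
    filter_upwards [heq, hres] with s hs hsr
    have h1 := hR₀.apply_sub_apply (isResolventAt_opResolvent hsr) b
    rw [hs, map_add, map_smul, map_smul, map_smul, smul_comm (s₀ - s), ← smul_add]
    congr 1
    rw [← sub_eq_zero] at h1 ⊢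
    rw [← neg_eq_zero, ← h1]; module
  have hn0 : n < 0 := by
    by_contra! hn0
    lift n to ℕ using hn0
    obtain ⟨y, -, hy⟩ := key (fun _ => 1) (fun s => (s - μ) ^ n • g s) continuousAt_const
      (((continuousAt_id.sub continuousAt_const).pow n).smul hg.continuousAt)
      (by filter_upwards [hfg] with s hs; rw [hs, one_smul, zpow_natCast])
    exact hb ⟨y, by rw [hy, one_smul]⟩
  refine ⟨n, hn0, g, hg, hfg, hg0, ?_⟩
  obtain ⟨m, rfl⟩ : ∃ m : ℕ, n = -(m : ℤ) := ⟨n.natAbs, by omega⟩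
  -- Since `m > 0`, this factor vanishes at `μ` and the limit equation is homogeneous.
  obtain ⟨y, hy, hy'⟩ := key (fun s => (s - μ) ^ m) g
    ((continuousAt_id.sub continuousAt_const).pow m) hg.continuousAt (by
      filter_upwards [hfg, self_mem_nhdsWithin] with s hs hne
      rw [hs, smul_smul, zpow_neg, zpow_natCast, mul_inv_cancel₀ (pow_ne_zero _
        (sub_ne_zero.2 hne)), one_smul])
  refine ⟨y, hy, ?_⟩
  have hm : m ≠ 0 := by omega
  simp only [sub_self, zero_pow hm, zero_smul] at hy'
  exact (sub_eq_zero.1 hy').symm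

/-! ### Minimality and poles of the transfer function -/

namespace ControlSystem

theorem IsMinimal.C_apply_ne_zero {Z : Type*} [NormedAddCommGroup Z] [InnerProductSpace ℂ Z]
    {S : ControlSystem Z} (hmin : S.IsMinimal) {μ : ℂ} (hμ : μ ∈ opSpectrum S.A)
    {y : S.A.domain} (hy0 : (y : Z) ≠ 0) (hy : S.A y = μ • (y : Z)) : S.C y ≠ 0 := by
  intro hC
  refine Set.eq_empty_iff_forall_notMem.1 hmin μ ⟨⟨y, 0, hy0, ?_, ?_⟩, hμ⟩
  · rw [hy]; simp
  · rw [hC]; simp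

theorem IsMinimal.b_notMem_range {Z : Type*} [NormedAddCommGroup Z] [InnerProductSpace ℂ Z]
    {S : ControlSystem Z} (hmin : S.IsMinimal) {μ : ℂ} (hμ : μ ∈ opSpectrum S.A)
    (hev : IsOpEigenvalue S.A μ) : ¬∃ y : S.A.domain, μ • (y : Z) - S.A y = S.b := by
  rintro ⟨y, hy⟩
  obtain ⟨v, hv0, hv⟩ := hev
  have hCv := hmin.C_apply_ne_zero hμ hv0 hv
  -- Chosen so that `C (y + α v) + D = 0`.
  set α : ℂ := -(S.C y + S.D) / S.C v with hα
  have heq : μ • ((y + α • v : S.A.domain) : Z) - S.A (y + α • v) = S.b := by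
    rw [LinearPMap.map_add, LinearPMap.map_smul, hv, ← hy, Submodule.coe_add, Submodule.coe_smul]
    module
  refine Set.eq_empty_iff_forall_notMem.1 hmin μ ⟨⟨y + α • v, 1, ?_, ?_, ?_⟩, hμ⟩
  · intro h0
    have h0' : y + α • v = 0 := Subtype.ext h0
    rw [h0'] at heq
    exact S.b_ne_zero (by rw [← heq]; simp)
  · rw [heq]; simp [B]
  · rw [Submodule.coe_add, Submodule.coe_smul, map_add, map_smul, smul_eq_mul, hα,
      div_mul_cancel₀ _ hCv]
    ring

theorem transferFunction_eq {Z : Type*} [NormedAddCommGroup Z] [InnerProductSpace ℂ Z]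
    (S : ControlSystem Z) :
    S.transferFunction = (fun s => S.C (opResolvent S.A s S.b)) + fun _ => S.D := by
  funext s
  simp [transferFunction, B]

theorem analyticAt_transferFunction {Z : Type*} [NormedAddCommGroup Z] [InnerProductSpace ℂ Z]
    [CompleteSpace Z] (S : ControlSystem Z) {s : ℂ} (hs : s ∈ opResolventSet S.A) :
    AnalyticAt ℂ S.transferFunction s := by
  rw [transferFunction_eq]
  exact (((S.C.comp (ContinuousLinearMap.apply ℂ Z S.b)).analyticAt _).comp
    (analyticAt_opResolvent hs)).add analyticAt_const

theorem meromorphicOrderAt_transferFunction_neg {Z : Type*} [NormedAddCommGroup Z]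
    [InnerProductSpace ℂ Z] [CompleteSpace Z] {S : ControlSystem Z} (hmin : S.IsMinimal) {μ : ℂ}
    (hμ : μ ∈ opSpectrum S.A) (hiso : IsIsolatedEigenvalueOfFiniteMultiplicity S.A μ) :
    meromorphicOrderAt S.transferFunction μ < 0 := by
  have hres : ∀ᶠ s in 𝓝[≠] μ, s ∈ opResolventSet S.A := by
    obtain ⟨-, r, hr, hball, -⟩ := hiso
    exact eventually_mem_opResolventSet hr hball
  obtain ⟨n, hn, g, hg, hfg, hg0, y, hy, hAy⟩ := exists_leadingCoeff_opResolvent_apply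
    (meromorphicAt_opResolvent_apply hiso S.b) hres (hmin.b_notMem_range hμ hiso.1)
  have hC : S.C (g μ) ≠ 0 := hy ▸ hmin.C_apply_ne_zero hμ (hy.symm ▸ hg0) hAy
  have hCg : AnalyticAt ℂ (fun s => S.C (g s)) μ := (S.C.analyticAt _).comp hg
  have heq : ∀ᶠ s in 𝓝[≠] μ, S.C (opResolvent S.A s S.b) = (s - μ) ^ n • S.C (g s) := by
    filter_upwards [hfg] with s hs
    rw [hs, map_smul]
  have hmer : MeromorphicAt (fun s => S.C (opResolvent S.A s S.b)) μ := by
    refine MeromorphicAt.congr (f := fun s => (s - μ) ^ n • S.C (g s)) ?_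
      (heq.mono fun s hs => hs.symm)
    exact (((MeromorphicAt.id μ).sub (MeromorphicAt.const μ μ)).zpow n).smul hCg.meromorphicAt
  have hord : meromorphicOrderAt (fun s => S.C (opResolvent S.A s S.b)) μ = n :=
    (meromorphicOrderAt_eq_int_iff hmer).2 ⟨_, hCg, hC, heq⟩
  have hneg : meromorphicOrderAt (fun s => S.C (opResolvent S.A s S.b)) μ < 0 := by
    rw [hord]; exact_mod_cast hn
  rw [transferFunction_eq, meromorphicOrderAt_add_eq_left_of_lt (MeromorphicAt.const S.D μ)]
  · exact hneg
  · exact hneg.trans_le analyticAt_const.meromorphicOrderAt_nonneg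

end ControlSystem

theorem mainTheorem11 {Z : Type*} [NormedAddCommGroup Z] [InnerProductSpace ℂ Z] [CompleteSpace Z]
    (S : ControlSystem Z)
    (hne : (opSpectrum S.A).Nonempty)
    (hspec : ∀ μ ∈ opSpectrum S.A, IsIsolatedEigenvalueOfFiniteMultiplicity S.A μ)
    (hmin : S.IsMinimal) :
    AnalyticOnNhd ℂ S.transferFunction (opResolventSet S.A) ∧
      MeromorphicOn S.transferFunction Set.univ ∧
      (∀ μ ∈ opSpectrum S.A, meromorphicOrderAt S.transferFunction μ < 0) ∧
      ∃ s ∈ opResolventSet S.A, S.transferFunction s ≠ 0 := by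
  have hpole : ∀ μ ∈ opSpectrum S.A, meromorphicOrderAt S.transferFunction μ < 0 := fun μ hμ =>
    ControlSystem.meromorphicOrderAt_transferFunction_neg hmin hμ (hspec μ hμ)
  have hmero : ∀ μ, MeromorphicAt S.transferFunction μ := by
    intro μ
    by_cases hμ : μ ∈ opResolventSet S.A
    · exact (S.analyticAt_transferFunction hμ).meromorphicAt
    -- `meromorphicOrderAt` defaults to `0` at points of non-meromorphy, so a negative order already
    -- implies meromorphy.
    · by_contra h
      have h0 := hpole μ hμ
      rw [meromorphicOrderAt_of_not_meromorphicAt h] at h0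
      exact lt_irrefl _ h0
  refine ⟨fun s hs => S.analyticAt_transferFunction hs, fun μ _ => hmero μ, hpole, ?_⟩
  obtain ⟨μ, hμ⟩ := hne
  obtain ⟨-, r, hr, hball, -⟩ := hspec μ hμ
  have hnz := (meromorphicOrderAt_ne_top_iff_eventually_ne_zero (hmero μ)).1
    (hpole μ hμ).ne_top
  exact ((eventually_mem_opResolventSet hr hball).and hnz).exists
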